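/- A finite relational signature consists of finitely many relation symbols, each of some arity at least $1$. A first-order sentence over a signature is built from equalities and relation atoms with the boolean connectives and quantifiers; we consider only its finite models, with nonempty universe. A \emph{tree decomposition} of a finite structure $\mathsf{S}$ is a finite tree whose every node $t$ is labelled by a set $\lambda(t)$ of elements of $\mathsf{S}$, such that (1) for each relation symbol and each tuple in its interpretation some $\lambda(t)$ contains all the elements of the tuple, and (2) for each element $u$ that occurs in a tuple of some relation, the set of nodes $t$ with $u \in \lambda(t)$ is nonempty and connected in the tree. Its \emph{width} is $\max_t |\lambda(t)| - 1$, and the \emph{treewidth} of $\mathsf{S}$ is the least width of a tree decomposition of $\mathsf{S}$. A sentence $\varphi$ is called \emph{treewidth-bounded} if the set of treewidths of its finite models is finite. \textbf{Theorem.} There is a natural number $k$ such that, for every finite relational signature with at least two binary relation symbols and at least $k$ unary relation symbols, the following problem is undecidable: given a first-order sentence $\varphi$ over the signature, is $\varphi$ treewidth-bounded? That is, no computable function, given the code (in a standard numbering) of a sentence $\varphi$ over the signature, decides correctly whether $\varphi$ is treewidth-bounded. -/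

import Mathlib

open scoped FirstOrder

/-- A finite relational signature: finitely many relation symbols, each of arity at least one. -/
structure RelSignature where
  size : ℕ
  arity : Fin size → ℕ
  one_le_arity : ∀ i, 1 ≤ arity i

namespace RelSignature

/-- The first-order language (with equality) of a relational signature: it has no function symbols,
and its `n`-ary relation symbols are the symbols of the signature that have arity `n`. -/
def lang (S : RelSignature) : FirstOrder.Language.{0, 0} where
  Functions := fun _ => Empty
  Relations := fun n => {i : Fin S.size // S.arity i = n}

/-- The number of relation symbols of arity `n`. -/
def numOfArity (S : RelSignature) (n : ℕ) : ℕ :=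
  (Finset.univ.filter fun i => S.arity i = n).card

/-! ### Tree decompositions and treewidth of finite structures -/

/-- The support of a structure: the elements that occur in some tuple of some relation. -/
def support (S : RelSignature) (M : Type) [S.lang.Structure M] : Set M :=
  {u | ∃ (n : ℕ) (R : S.lang.Relations n) (x : Fin n → M),
    FirstOrder.Language.Structure.RelMap R x ∧ ∃ i, x i = u}

/-- A tree decomposition of a structure: a finite tree, whose nodes are labelled by sets of elements
(bags), such that every tuple of every relation is contained in some bag, and, for every element of
the support, the set of nodes whose bags contain it is nonempty and connected in the tree. -/
structure TreeDecomposition (S : RelSignature) (M : Type) [S.lang.Structure M] where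
  order : ℕ
  tree : SimpleGraph (Fin order)
  isTree : tree.IsTree
  bag : Fin order → Finset M
  exists_bag : ∀ {n : ℕ} (R : S.lang.Relations n) (x : Fin n → M),
    FirstOrder.Language.Structure.RelMap R x → ∃ t, ∀ i, x i ∈ bag t
  connected : ∀ u ∈ S.support M, (tree.induce {t | u ∈ bag t}).Connected

/-- The width: the maximal cardinality of a bag, minus one. -/
def TreeDecomposition.width {S : RelSignature} {M : Type} [S.lang.Structure M]
    (D : S.TreeDecomposition M) : ℤ :=
  ((Finset.univ.sup fun t => (D.bag t).card : ℕ) : ℤ) - 1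

/-- The treewidth of a finite structure: the least width of a tree decomposition. -/
noncomputable def treewidth (S : RelSignature) (M : Type) [S.lang.Structure M] : ℤ :=
  sInf (Set.range fun D : S.TreeDecomposition M => D.width)

/-- The tree decomposition of a finite structure with a single bag. -/
def TreeDecomposition.single (S : RelSignature) (M : Type) [S.lang.Structure M] [Fintype M] :
    S.TreeDecomposition M where
  order := 1
  tree := ⊥
  isTree := SimpleGraph.IsTree.of_subsingleton
  bag := fun _ => Finset.univ
  exists_bag := fun _ _ _ => ⟨0, fun _ => Finset.mem_univ _⟩
  connected := fun u _ => by
    have : Nonempty {t : Fin 1 | u ∈ (Finset.univ : Finset M)} := ⟨⟨0, Finset.mem_univ _⟩⟩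
    exact { preconnected := SimpleGraph.Preconnected.of_subsingleton }

/-- On finite structures the infimum in the definition of the treewidth is a minimum. -/
theorem isLeast_treewidth (S : RelSignature) (M : Type) [S.lang.Structure M] [Finite M] :
    IsLeast (Set.range fun D : S.TreeDecomposition M => D.width) (S.treewidth M) := by
  have := Fintype.ofFinite M
  have hne : (Set.range fun D : S.TreeDecomposition M => D.width).Nonempty :=
    ⟨_, TreeDecomposition.single S M, rfl⟩
  have hb : BddBelow (Set.range fun D : S.TreeDecomposition M => D.width) := by
    refine ⟨-1, ?_⟩
    rintro _ ⟨D, rfl⟩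
    simp only [TreeDecomposition.width]
    omega
  exact ⟨Int.csInf_mem hne hb, fun w hw => csInf_le hb hw⟩

/-- The set of treewidths of the finite models (with nonempty universe) of a sentence. -/
def modelTreewidths (S : RelSignature) (φ : S.lang.Sentence) : Set ℤ :=
  {w | ∃ (M : Type) (_ : S.lang.Structure M), Finite M ∧ Nonempty M ∧ M ⊨ φ ∧ S.treewidth M = w}

/-- The set of finite models of a sentence is treewidth-bounded. -/
def TreewidthBounded (S : RelSignature) (φ : S.lang.Sentence) : Prop :=
  (S.modelTreewidths φ).Finite

/-! ### Coding sentences by natural numbers -/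

/-- The code of a term: terms are variables, and a bound variable is coded by its index. -/
def termCode (S : RelSignature) {n : ℕ} : S.lang.Term (Empty ⊕ Fin n) → ℕ
  | .var (.inl e) => e.elim
  | .var (.inr i) => i
  | .func f _ => Empty.elim f

/-- The standard recursive numbering of the formulas over the signature. -/
def code (S : RelSignature) : {n : ℕ} → S.lang.BoundedFormula Empty n → ℕ
  | _, .falsum => Nat.pair 0 0
  | _, .equal s t => Nat.pair 1 (Nat.pair (S.termCode s) (S.termCode t))
  | _, .rel R ts =>
      Nat.pair 2 (Nat.pair R.1 (Encodable.encode (List.ofFn fun j => S.termCode (ts j))))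
  | _, .imp φ ψ => Nat.pair 3 (Nat.pair (S.code φ) (S.code ψ))
  | _, .all φ => Nat.pair 4 (S.code φ)

theorem termCode_injective (S : RelSignature) {n : ℕ} :
    Function.Injective (S.termCode (n := n)) := by
  intro s t h
  cases s with
  | func f _ => exact Empty.elim f
  | var a =>
    cases t with
    | func f _ => exact Empty.elim f
    | var b =>
      rcases a with e | i
      · exact e.elim
      rcases b with e | j
      · exact e.elim
      obtain rfl : i = j := Fin.ext h
      rfl

/-- Distinct formulas have distinct codes. -/
theorem code_injective (S : RelSignature) {n : ℕ} : Function.Injective (S.code (n := n)) := by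
  intro φ
  induction φ with
  | falsum => intro ψ h; cases ψ <;> simp_all [code, Nat.pair_eq_pair]
  | equal s t =>
    intro ψ h
    cases ψ <;> simp_all [code, Nat.pair_eq_pair, S.termCode_injective.eq_iff]
  | rel R ts =>
    intro ψ h
    cases ψ <;> simp only [code, Nat.pair_eq_pair] at h <;> try omega
    rename_i R' ts'
    obtain ⟨R, rfl⟩ := R
    obtain ⟨R', hR'⟩ := R'
    obtain ⟨-, h1, h2⟩ := h
    obtain rfl : R = R' := Fin.ext h1
    subst hR'
    have h3 := List.ofFn_injective (Encodable.encode_injective h2)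
    have h4 : ts = ts' := funext fun j => S.termCode_injective (congrFun h3 j)
    rw [h4]
  | imp φ₁ φ₂ h₁ h₂ =>
    intro ψ h
    cases ψ <;> simp only [code, Nat.pair_eq_pair] at h <;> try omega
    rw [h₁ h.2.1, h₂ h.2.2]
  | all φ h₁ =>
    intro ψ h
    cases ψ <;> simp only [code, Nat.pair_eq_pair] at h <;> try omega
    rw [h₁ h.2]

/-- The treewidth-boundedness problem for first-order sentences over the signature is decidable:
some computable function tells, from the code of any sentence, whether the set of finite models of
the sentence is treewidth-bounded. -/
def TreewidthBoundednessDecidable (S : RelSignature) : Prop :=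
  ∃ d : ℕ → Bool, Computable d ∧
    ∀ φ : S.lang.Sentence, d (S.code φ) = true ↔ S.TreewidthBounded φ

end RelSignature

/-! The non-halting problem of one fixed program `c` with undecidable domain reduces to
treewidth-boundedness. To an input `n` corresponds a sentence that has no finite model if `c`
diverges at `n`, and has models of every large finite size if `c` halts at `n`. Every model is
linearly ordered by a binary relation, so its Gaifman graph is complete and its treewidth grows with
its size (Helly property of subtrees, `le_treewidth_of_clique`). An empty class of models is
trivially bounded, so the sentence is treewidth-bounded exactly if `c` diverges at `n`
(`treewidthBounded_iff`).

A finite linear order is an initial segment of ℕ. The second binary relation and one unary predicate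
encode unpairing, axiomatized by its recursion along successors (`Nat.unpair_succ`). A function
graph then becomes a set of elements, so one unary predicate per subprogram of `c` records its
values, and a further predicate marks the input. Recorded values are only required to be justified
by other recorded values. In a finite model this makes them correct (`HereditarilySound.mem_eval`);
conversely, step-bounded evaluation fills every long enough segment with justified records
(`standard_sound`).

The number of predicates depends on `c` alone. The input enters through quantifiers only
(`markSentence`), and the code of the sentence is primitive recursive in `n`. -/

namespace SimpleGraph

/-! ### The Helly property for subtrees of a tree. -/

variable {V : Type*} {G : SimpleGraph V}

/-- A set of vertices that contains every path between any two of its elements. -/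
def PathConvex (G : SimpleGraph V) (A : Set V) : Prop :=
  ∀ ⦃x y : V⦄, x ∈ A → y ∈ A → ∀ p : G.Walk x y, p.IsPath → ∀ z ∈ p.support, z ∈ A

theorem PathConvex.inter {A B : Set V} (hA : G.PathConvex A) (hB : G.PathConvex B) :
    G.PathConvex (A ∩ B) :=
  fun _ _ hx hy p hp z hz => ⟨hA hx.1 hy.1 p hp z hz, hB hx.2 hy.2 p hp z hz⟩

theorem IsAcyclic.pathConvex_of_connected (hG : G.IsAcyclic) {A : Set V}
    (hA : (G.induce A).Connected) : G.PathConvex A := by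
  classical
  intro x y hx hy p hp z hz
  obtain ⟨q⟩ := hA.preconnected ⟨x, hx⟩ ⟨y, hy⟩
  let q' : G.Walk x y := q.map (Embedding.induce A).toHom
  have hq : p = q'.bypass :=
    congrArg Subtype.val ((hG.subsingleton_path x y).elim ⟨p, hp⟩ ⟨q'.bypass, q'.bypass_isPath⟩)
  rw [hq] at hz
  have hz' := q'.support_bypass_subset_support hz
  rw [show q'.support = _ from Walk.support_map _ _] at hz'
  obtain ⟨w, -, rfl⟩ := List.mem_map.1 hz'
  exact w.2

/-- As long as the walk has not reached `C`, its next edge must lie in `A`; hence its first vertex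
in `C` is still in `A`. -/
theorem Walk.exists_mem_support_inter {A C : Set V} {p q : V} (w : G.Walk p q)
    (hp : p ∈ A) (hq : q ∈ C)
    (hw : ∀ d ∈ w.darts, (d.fst ∈ A ∧ d.snd ∈ A) ∨ (d.fst ∈ C ∧ d.snd ∈ C)) :
    ∃ z ∈ w.support, z ∈ A ∧ z ∈ C := by
  induction w with
  | nil => exact ⟨_, by simp, hp, hq⟩
  | @cons u v _ h w ih =>
    by_cases hu : u ∈ C
    · exact ⟨u, by simp, hp, hu⟩
    · have hv : v ∈ A := by
        rcases hw ⟨(u, v), h⟩ (by simp) with h' | h'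
        · exact h'.2
        · exact absurd h'.1 hu
      obtain ⟨z, hz, hz'⟩ := ih hv hq fun d hd => hw d (by simp [hd])
      exact ⟨z, by simp [hz], hz'⟩

/-- Three pairwise intersecting subtrees of a tree have a common vertex. -/
theorem IsTree.inter_three_nonempty (hG : G.IsTree) {A B C : Set V} (hA : G.PathConvex A)
    (hB : G.PathConvex B) (hC : G.PathConvex C) (hAB : (A ∩ B).Nonempty) (hBC : (B ∩ C).Nonempty)
    (hAC : (A ∩ C).Nonempty) : (A ∩ B ∩ C).Nonempty := by
  classical
  obtain ⟨p, hpA, hpB⟩ := hAB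
  obtain ⟨q, hqB, hqC⟩ := hBC
  obtain ⟨r, hrA, hrC⟩ := hAC
  obtain ⟨w₁, h₁, -⟩ := hG.existsUnique_path p r
  obtain ⟨w₂, h₂, -⟩ := hG.existsUnique_path r q
  have hw₁ := hA hpA hrA w₁ h₁
  have hw₂ := hC hrC hqC w₂ h₂
  -- The path from `p` to `q` is cut out of the detour through `r`, so each of its edges lies in `A`
  -- or in `C`. Being a path between points of `B`, it stays in `B`.
  obtain ⟨z, hz, hzA, hzC⟩ := ((w₁.append w₂).bypass).exists_mem_support_inter hpA hqC (by
    intro d hd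
    have hd' := (w₁.append w₂).darts_bypass_subset_darts hd
    rw [Walk.darts_append, List.mem_append] at hd'
    rcases hd' with h | h
    · exact .inl ⟨hw₁ _ (w₁.dart_fst_mem_support_of_mem_darts h),
        hw₁ _ (w₁.dart_snd_mem_support_of_mem_darts h)⟩
    · exact .inr ⟨hw₂ _ (w₂.dart_fst_mem_support_of_mem_darts h),
        hw₂ _ (w₂.dart_snd_mem_support_of_mem_darts h)⟩)
  exact ⟨z, ⟨hzA, hB hpB hqB _ (Walk.bypass_isPath _) z hz⟩, hzC⟩

/-- The Helly property of subtrees of a tree. -/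
theorem IsTree.helly (hG : G.IsTree) {ι : Type*} (s : Finset ι) (hs : s.Nonempty)
    (A : ι → Set V) (hA : ∀ i ∈ s, G.PathConvex (A i))
    (hne : ∀ i ∈ s, ∀ j ∈ s, (A i ∩ A j).Nonempty) : ∃ v, ∀ i ∈ s, v ∈ A i := by
  classical
  induction hs using Finset.Nonempty.cons_induction generalizing A with
  | singleton a =>
    obtain ⟨v, hv, -⟩ := hne a (by simp) a (by simp)
    exact ⟨v, by simpa using hv⟩
  | cons a s ha hs ih =>
    obtain ⟨v, hv⟩ := ih (fun i => A i ∩ A a)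
      (fun i hi => (hA i (by simp [hi])).inter (hA a (by simp))) (by
        intro i hi j hj
        obtain ⟨v, ⟨h₁, h₂⟩, h₃⟩ := hG.inter_three_nonempty (hA i (by simp [hi]))
          (hA j (by simp [hj])) (hA a (by simp)) (hne i (by simp [hi]) j (by simp [hj]))
          (hne j (by simp [hj]) a (by simp)) (hne i (by simp [hi]) a (by simp))
        exact ⟨v, ⟨h₁, h₃⟩, h₂, h₃⟩)
    obtain ⟨i, hi⟩ := hs
    exact ⟨v, fun j hj => (Finset.mem_cons.1 hj).elim (fun h => h ▸ (hv i hi).2)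
      fun h => (hv j h).1⟩

end SimpleGraph

/-! ### Cliques as lower bounds for treewidth. -/

namespace RelSignature

/-- A clique of the Gaifman graph is contained in some bag. -/
theorem TreeDecomposition.exists_subset_bag {S : RelSignature} {M : Type} [S.lang.Structure M]
    (D : S.TreeDecomposition M) (K : Finset M) (hK : 1 < K.card)
    (h : ∀ a ∈ K, ∀ b ∈ K, a ≠ b → ∃ (n : ℕ) (R : S.lang.Relations n) (x : Fin n → M),
      FirstOrder.Language.Structure.RelMap R x ∧ a ∈ Set.range x ∧ b ∈ Set.range x) :
    ∃ t, K ⊆ D.bag t := by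
  have hex : ∀ a ∈ K, ∃ b ∈ K, a ≠ b := fun a _ => by
    obtain ⟨b, hb, hab⟩ := Finset.exists_mem_ne hK a
    exact ⟨b, hb, hab.symm⟩
  have hsupp : ∀ a ∈ K, a ∈ S.support M := fun a ha => by
    obtain ⟨b, hb, hab⟩ := hex a ha
    obtain ⟨n, R, x, hx, ⟨i, hi⟩, -⟩ := h a ha b hb hab
    exact ⟨n, R, x, hx, i, hi⟩
  have hmeet : ∀ a ∈ K, ∀ b ∈ K, a ≠ b → ∃ t, a ∈ D.bag t ∧ b ∈ D.bag t :=
    fun a ha b hb hab => by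
      obtain ⟨n, R, x, hx, ⟨i, rfl⟩, ⟨j, rfl⟩⟩ := h a ha b hb hab
      obtain ⟨t, ht⟩ := D.exists_bag R x hx
      exact ⟨t, ht i, ht j⟩
  obtain ⟨t, ht⟩ := D.isTree.helly K (Finset.card_pos.1 (by omega)) (fun u => {t | u ∈ D.bag t})
    (fun u hu => D.isTree.isAcyclic.pathConvex_of_connected (D.connected u (hsupp u hu))) (by
      intro a ha b hb
      by_cases hab : a = b
      · obtain ⟨c, hc, hac⟩ := hex a ha
        obtain ⟨t, ht, -⟩ := hmeet a ha c hc hac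
        exact ⟨t, ht, hab ▸ ht⟩
      · exact hmeet a ha b hb hab)
  exact ⟨t, ht⟩

/-- The treewidth is at least the size of a clique of the Gaifman graph, minus one. -/
theorem le_treewidth_of_clique (S : RelSignature) {M : Type} [S.lang.Structure M] [Finite M]
    (K : Finset M) (hK : 1 < K.card)
    (h : ∀ a ∈ K, ∀ b ∈ K, a ≠ b → ∃ (n : ℕ) (R : S.lang.Relations n) (x : Fin n → M),
      FirstOrder.Language.Structure.RelMap R x ∧ a ∈ Set.range x ∧ b ∈ Set.range x) :
    (K.card : ℤ) - 1 ≤ S.treewidth M := by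
  obtain ⟨D, hD⟩ := (S.isLeast_treewidth M).1
  obtain ⟨t, ht⟩ := D.exists_subset_bag K hK h
  have h₁ : K.card ≤ Finset.univ.sup fun t => (D.bag t).card :=
    (Finset.card_le_card ht).trans (Finset.le_sup (f := fun t => (D.bag t).card) (Finset.mem_univ t))
  rw [← hD]
  simp only [TreeDecomposition.width]
  omega

end RelSignature

/-! ### Axioms for order, pairing and recorded computations. -/

open Nat.Partrec (Code)

/-- Unpairing becomes a recursion along the successor that uses only comparisons, successors and
zero, all definable from the order without arithmetic. -/
theorem Nat.unpair_succ (n : ℕ) :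
    Nat.unpair (n + 1) =
      if (Nat.unpair n).1 < (Nat.unpair n).2 then
        if (Nat.unpair n).1 + 1 < (Nat.unpair n).2 then ((Nat.unpair n).1 + 1, (Nat.unpair n).2)
        else ((Nat.unpair n).1 + 1, 0)
      else if (Nat.unpair n).2 < (Nat.unpair n).1 then ((Nat.unpair n).1, (Nat.unpair n).2 + 1)
      else (0, (Nat.unpair n).1 + 1) := by
  have hn := Nat.pair_unpair n
  generalize Nat.unpair n = u at hn ⊢
  obtain ⟨a, b⟩ := u
  dsimp only at hn ⊢
  have key : ∀ c d : ℕ, Nat.pair c d = n + 1 → Nat.unpair (n + 1) = (c, d) := fun c d h => by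
    rw [← h, Nat.unpair_pair]
  split_ifs with h₁ h₂ h₂ <;> apply key <;> rw [← hn]
  · simp only [Nat.pair, h₁, h₂, if_true]; ring
  · obtain rfl : b = a + 1 := by omega
    simp only [Nat.pair, h₁, if_true, Nat.not_lt_zero, if_false]; ring
  · have : ¬ a < b + 1 := by omega
    simp only [Nat.pair, h₁, this, if_false]; ring
  · obtain rfl : b = a := by omega
    simp only [Nat.pair, lt_irrefl, if_false, Nat.succ_pos, if_true]; ring

/-- An interpretation of two binary symbols and infinitely many unary symbols. -/
structure Interp (M : Type*) where
  lt : M → M → Prop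
  E : M → M → Prop
  P : ℕ → M → Prop

namespace Interp

variable {M : Type*} (I : Interp M)

def IsZero (x : M) : Prop := ∀ y, ¬ I.lt y x

def IsSucc (x y : M) : Prop := I.lt x y ∧ ∀ z, I.lt z y → ¬ I.lt x z

/-- The set of `E`-neighbours of `p` is to consist of the two components of the pair coded by `p`;
the first component is the smaller one if and only if the unary predicate `P 0` holds at `p`. -/
def Fst (p a : M) : Prop :=
  I.E p a ∧ (I.P 0 p → ∀ b, I.E p b → ¬ I.lt b a) ∧ (¬ I.P 0 p → ∀ b, I.E p b → ¬ I.lt a b)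

def Snd (p a : M) : Prop :=
  I.E p a ∧ (¬ I.P 0 p → ∀ b, I.E p b → ¬ I.lt b a) ∧ (I.P 0 p → ∀ b, I.E p b → ¬ I.lt a b)

def LinearOrderAxioms : Prop :=
  (∀ x, ¬ I.lt x x) ∧ (∀ x y z, I.lt x y → I.lt y z → I.lt x z) ∧
    ∀ x y, ¬ I.lt x y → ¬ I.lt y x → x = y

/-- The recursive description of the inverse of the pairing function. -/
def PairingAxioms : Prop :=
  (∀ p, I.IsZero p → I.Fst p p ∧ I.Snd p p) ∧
    ∀ p q a b, I.IsSucc p q → I.Fst p a → I.Snd p b →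
      (I.lt a b → ∃ c, I.IsSucc a c ∧ (I.lt c b → I.Fst q c ∧ I.Snd q b) ∧
        (¬ I.lt c b → ∃ z, I.IsZero z ∧ I.Fst q c ∧ I.Snd q z)) ∧
      (I.lt b a → ∃ c, I.IsSucc b c ∧ I.Fst q a ∧ I.Snd q c) ∧
      (¬ I.lt a b → ¬ I.lt b a → ∃ c z, I.IsSucc a c ∧ I.IsZero z ∧ I.Fst q z ∧ I.Snd q c)

/-- The graph of the function computed by `c`, as recorded by the predicate `P (encode c + 2)`. -/
def Eval (c : Code) (x y : M) : Prop :=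
  ∃ p, I.P (Encodable.encode c + 2) p ∧ I.Fst p x ∧ I.Snd p y

/-- The value `y` of `c` at `x` follows from other recorded values. -/
def Justified : Code → M → M → Prop
  | .zero, _, y => I.IsZero y
  | .succ, x, y => I.IsSucc x y
  | .left, x, y => I.Fst x y
  | .right, x, y => I.Snd x y
  | .pair f g, x, y => ∃ a b, I.Eval f x a ∧ I.Eval g x b ∧ I.Fst y a ∧ I.Snd y b
  | .comp f g, x, y => ∃ z, I.Eval g x z ∧ I.Eval f z y
  | .prec f g, x, y => ∃ a m, I.Fst x a ∧ I.Snd x m ∧ (I.IsZero m → I.Eval f a y) ∧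
      -- Here `x'` codes `(a, k)`, `r` codes `(k, i)` and `q` codes `(a, (k, i))`, the argument of
      -- `g` in the recursion step.
      ∀ k, I.IsSucc k m → ∃ x' i q r, I.Fst x' a ∧ I.Snd x' k ∧ I.Eval (.prec f g) x' i ∧
        I.Fst q a ∧ I.Snd q r ∧ I.Fst r k ∧ I.Snd r i ∧ I.Eval g q y
  | .rfind' f, x, y => ∃ a m v, I.Fst x a ∧ I.Snd x m ∧ I.Eval f x v ∧
      -- Incomparability stands for `y = m`.
      (I.IsZero v → ¬ I.lt y m ∧ ¬ I.lt m y) ∧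
      (¬ I.IsZero v → ∃ x' m', I.IsSucc m m' ∧ I.Fst x' a ∧ I.Snd x' m' ∧ I.Eval (.rfind' f) x' y)

def Sound (c : Code) : Prop := ∀ x y, I.Eval c x y → I.Justified c x y

/-- All recorded values of the subprograms of a program are justified. -/
def HereditarilySound : Code → Prop
  | .pair f g => I.Sound (.pair f g) ∧ HereditarilySound f ∧ HereditarilySound g
  | .comp f g => I.Sound (.comp f g) ∧ HereditarilySound f ∧ HereditarilySound g
  | .prec f g => I.Sound (.prec f g) ∧ HereditarilySound f ∧ HereditarilySound g
  | .rfind' f => I.Sound (.rfind' f) ∧ HereditarilySound f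
  | c => I.Sound c

/-- The predicate `P 1` marks a unique element, and the computation of `c` at this element
terminates. -/
def HaltsAtMark (c : Code) : Prop :=
  (∀ x y, I.P 1 x → I.P 1 y → ¬ I.lt x y) ∧ ∃ x y, I.P 1 x ∧ I.Eval c x y

def HaltingTheory (c : Code) : Prop :=
  I.LinearOrderAxioms ∧ I.PairingAxioms ∧ I.HereditarilySound c ∧ I.HaltsAtMark c

/-- An isomorphism of the order with an initial segment of the natural numbers. -/
structure Numbering (f : M → ℕ) : Prop where
  injective : f.Injective
  lt_iff : ∀ {x y}, I.lt x y ↔ f x < f y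
  exists_eq : ∀ {x m}, m ≤ f x → ∃ y, f y = m

/-- A numbering for which `Fst` and `Snd` are the components of the pairs coded by numbers. -/
structure PairNumbering (f : M → ℕ) : Prop extends I.Numbering f where
  fst_iff : ∀ {p a}, I.Fst p a ↔ f a = (f p).unpair.1
  snd_iff : ∀ {p a}, I.Snd p a ↔ f a = (f p).unpair.2

variable {I} {f : M → ℕ}

theorem LinearOrderAxioms.exists_numbering [Finite M] (h : I.LinearOrderAxioms) :
    ∃ f : M → ℕ, I.Numbering f := by
  classical
  have := Fintype.ofFinite M
  obtain ⟨h₁, h₂, h₃⟩ := h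
  have : IsStrictTotalOrder M I.lt := { irrefl := h₁, trans := h₂, trichotomous := h₃ }
  let : LinearOrder M := linearOrderOfSTO I.lt
  let e : Fin (Fintype.card M) ≃o M := Fintype.orderIsoFinOfCardEq M rfl
  refine ⟨fun x => e.symm x, fun x y hxy => e.symm.injective (Fin.ext hxy), fun {x y} => ?_,
    fun {x m} hm => ⟨e ⟨m, hm.trans_lt (e.symm x).2⟩, by simp⟩⟩
  exact (e.symm.lt_iff_lt (x := x) (y := y)).symm

theorem Numbering.isZero_iff (h : I.Numbering f) {x : M} : I.IsZero x ↔ f x = 0 := by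
  refine ⟨fun hx => ?_, fun hx y hy => ?_⟩
  · obtain ⟨y, hy⟩ := h.exists_eq (Nat.zero_le (f x))
    have := hx y
    rw [h.lt_iff] at this
    omega
  · rw [h.lt_iff] at hy
    omega

theorem Numbering.isSucc_iff (h : I.Numbering f) {x y : M} : I.IsSucc x y ↔ f y = f x + 1 := by
  simp only [IsSucc, h.lt_iff]
  refine ⟨fun ⟨h₁, h₂⟩ => ?_, fun hx => ⟨by omega, fun z => by omega⟩⟩
  obtain ⟨z, hz⟩ := h.exists_eq (x := y) (m := f x + 1) (by omega)
  have := h₂ z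
  omega

theorem Numbering.fst_unique (h : I.Numbering f) {p a b : M} (ha : I.Fst p a) (hb : I.Fst p b) :
    f a = f b := by
  simp only [Fst, h.lt_iff] at ha hb
  by_cases hp : I.P 0 p
  · have h₁ := ha.2.1 hp b hb.1
    have h₂ := hb.2.1 hp a ha.1
    omega
  · have h₁ := ha.2.2 hp b hb.1
    have h₂ := hb.2.2 hp a ha.1
    omega

theorem Numbering.snd_unique (h : I.Numbering f) {p a b : M} (ha : I.Snd p a) (hb : I.Snd p b) :
    f a = f b := by
  simp only [Snd, h.lt_iff] at ha hb
  by_cases hp : I.P 0 p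
  · have h₁ := ha.2.2 hp b hb.1
    have h₂ := hb.2.2 hp a ha.1
    omega
  · have h₁ := ha.2.1 hp b hb.1
    have h₂ := hb.2.1 hp a ha.1
    omega

/-- Induction along the order: the axioms carry out one step of `Nat.unpair_succ`. Uniqueness of the
components is separate, since they are extremal among the `E`-neighbours. -/
theorem PairingAxioms.exists_components (hI : I.PairingAxioms) (h : I.Numbering f) (n : ℕ) :
    ∀ p, f p = n → ∃ a b, I.Fst p a ∧ I.Snd p b ∧ f a = n.unpair.1 ∧ f b = n.unpair.2 := by
  induction n with
  | zero =>
    intro p hp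
    obtain ⟨h₁, h₂⟩ := hI.1 p (h.isZero_iff.2 hp)
    exact ⟨p, p, h₁, h₂, by simp [hp], by simp [hp]⟩
  | succ n ih =>
    intro q hq
    obtain ⟨p, hp⟩ := h.exists_eq (x := q) (m := n) (by omega)
    obtain ⟨a, b, ha, hb, ha', hb'⟩ := ih p hp
    obtain ⟨h₁, h₂, h₃⟩ := hI.2 p q a b (h.isSucc_iff.2 (by omega)) ha hb
    simp only [h.lt_iff, h.isSucc_iff, h.isZero_iff] at h₁ h₂ h₃
    rw [Nat.unpair_succ, ← ha', ← hb']
    split_ifs with h₄ h₅ h₅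
    · obtain ⟨c, hc, hc', -⟩ := h₁ h₄
      obtain ⟨hq₁, hq₂⟩ := hc' (by omega)
      exact ⟨c, b, hq₁, hq₂, hc, rfl⟩
    · obtain ⟨c, hc, -, hc'⟩ := h₁ h₄
      obtain ⟨z, hz, hq₁, hq₂⟩ := hc' (by omega)
      exact ⟨c, z, hq₁, hq₂, hc, hz⟩
    · obtain ⟨c, hc, hq₁, hq₂⟩ := h₂ h₅
      exact ⟨a, c, hq₁, hq₂, rfl, hc⟩
    · obtain ⟨c, z, hc, hz, hq₁, hq₂⟩ := h₃ h₄ h₅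
      exact ⟨z, c, hq₁, hq₂, hz, hc⟩

theorem PairingAxioms.pairNumbering (hI : I.PairingAxioms) (h : I.Numbering f) :
    I.PairNumbering f where
  toNumbering := h
  fst_iff {p a} := by
    obtain ⟨a', b', ha, hb, ha', hb'⟩ := hI.exists_components h _ p rfl
    refine ⟨fun h' => (h.fst_unique h' ha).trans ha', fun h' => ?_⟩
    rwa [h.injective (h'.trans ha'.symm)]
  snd_iff {p a} := by
    obtain ⟨a', b', ha, hb, ha', hb'⟩ := hI.exists_components h _ p rfl
    refine ⟨fun h' => (h.snd_unique h' hb).trans hb', fun h' => ?_⟩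
    rwa [h.injective (h'.trans hb'.symm)]

theorem Numbering.pairNumbering (h : I.Numbering f)
    (hE : ∀ p a, I.E p a ↔ f a = (f p).unpair.1 ∨ f a = (f p).unpair.2)
    (hP : ∀ p, I.P 0 p ↔ (f p).unpair.1 < (f p).unpair.2) : I.PairNumbering f := by
  -- Components never exceed the code of the pair, so an initial segment contains them.
  have key : ∀ p, (∃ a, f a = (f p).unpair.1) ∧ ∃ a, f a = (f p).unpair.2 := fun p =>
    ⟨h.exists_eq (Nat.unpair_left_le _), h.exists_eq (Nat.unpair_right_le _)⟩
  refine { h with fst_iff := fun {p a} => ?_, snd_iff := fun {p a} => ?_ }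
  all_goals
    obtain ⟨⟨u, hu⟩, v, hv⟩ := key p
    simp only [Fst, Snd, hE, hP, h.lt_iff]
    refine ⟨fun ⟨h₁, h₂, h₃⟩ => ?_, fun h₁ => ⟨by omega, fun _ _ _ => by omega,
      fun _ _ _ => by omega⟩⟩
    have h₂u := fun h => h₂ h u (.inl hu)
    have h₂v := fun h => h₂ h v (.inr hv)
    have h₃u := fun h => h₃ h u (.inl hu)
    have h₃v := fun h => h₃ h v (.inr hv)
    omega

theorem PairNumbering.pairingAxioms (h : I.PairNumbering f) : I.PairingAxioms := by
  simp only [PairingAxioms, h.lt_iff, h.isSucc_iff, h.isZero_iff, h.fst_iff, h.snd_iff]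
  refine ⟨fun p hp => by simp [hp], fun p q a b hq ha hb => ?_⟩
  have hle₁ := Nat.unpair_left_le (f p)
  have hle₂ := Nat.unpair_right_le (f p)
  obtain ⟨z, hz⟩ := h.exists_eq (Nat.zero_le (f q))
  rw [← ha] at hle₁
  rw [← hb] at hle₂
  rw [hq, Nat.unpair_succ, ← ha, ← hb]
  refine ⟨fun hab => ?_, fun hab => ?_, fun h₁ h₂ => ?_⟩
  · obtain ⟨c, hc⟩ := h.exists_eq (x := q) (m := f a + 1) (by omega)
    refine ⟨c, hc, fun hcb => ?_, fun hcb => ⟨z, hz, ?_⟩⟩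
    · rw [hc] at hcb
      simp [hab, hcb, hc]
    · rw [hc] at hcb
      simp [hab, hcb, hc, hz]
  · have hab' : ¬ f a < f b := by omega
    obtain ⟨c, hc⟩ := h.exists_eq (x := q) (m := f b + 1) (by omega)
    exact ⟨c, hc, by simp [hab, hab', hc]⟩
  · obtain ⟨c, hc⟩ := h.exists_eq (x := q) (m := f a + 1) (by omega)
    exact ⟨c, z, hc, hz, by simp [h₁, h₂, hc, hz]⟩

end Interp

/-! ### One-step unfoldings of step-bounded evaluation. -/

namespace Nat.Partrec.Code

theorem mem_evaln_pair {K : ℕ} {f g : Code} {x y : ℕ} :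
    y ∈ evaln K (pair f g) x ↔
      ∃ a ∈ evaln K f x, ∃ b ∈ evaln K g x, Nat.pair a b = y := by
  refine ⟨fun h => ?_, fun ⟨a, ha, b, hb, h⟩ => ?_⟩ <;> rcases K with - | K
  · simp [evaln] at h
  · simpa [evaln, Option.bind_eq_some_iff, Seq.seq] using And.right (by
      simpa [evaln, Option.bind_eq_some_iff, Seq.seq] using h)
  · simp [evaln] at ha
  · have := Nat.lt_succ_iff.1 (evaln_bound ha)
    simp only [evaln, Option.mem_def] at ha hb ⊢
    simp [Seq.seq, this, ha, hb, h]

theorem mem_evaln_comp {K : ℕ} {f g : Code} {x y : ℕ} (h : y ∈ evaln K (comp f g) x) :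
    ∃ z ∈ evaln K g x, y ∈ evaln K f z := by
  rcases K with - | K
  · simp [evaln] at h
  · exact (by simpa [evaln, Option.bind_eq_some_iff] using h : _ ∧ _).2

/-- The recursive call runs with a smaller bound and is raised back to `K` by monotonicity. Thus the
values recorded at one fixed `K` justify each other. -/
theorem mem_evaln_prec {K : ℕ} {f g : Code} {x y : ℕ} (h : y ∈ evaln K (prec f g) x) :
    (x.unpair.2 = 0 → y ∈ evaln K f x.unpair.1) ∧
      ∀ k, x.unpair.2 = k + 1 → ∃ i ∈ evaln K (prec f g) (Nat.pair x.unpair.1 k),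
        y ∈ evaln K g (Nat.pair x.unpair.1 (Nat.pair k i)) := by
  rcases K with - | K
  · simp [evaln] at h
  · simp only [evaln, Nat.unpaired, Option.mem_def, bind, Option.bind_eq_some_iff] at h
    obtain ⟨-, -, h⟩ := h
    refine ⟨fun h₀ => ?_, fun k hk => ?_⟩
    · simpa [h₀] using h
    · simp only [hk, Option.bind_eq_some_iff] at h
      obtain ⟨i, hi, h⟩ := h
      exact ⟨i, evaln_mono K.le_succ hi, h⟩

theorem mem_evaln_rfind' {K : ℕ} {f : Code} {x y : ℕ} (h : y ∈ evaln K (rfind' f) x) :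
    ∃ v ∈ evaln K f x, (v = 0 → y = x.unpair.2) ∧
      (v ≠ 0 → y ∈ evaln K (rfind' f) (Nat.pair x.unpair.1 (x.unpair.2 + 1))) := by
  rcases K with - | K
  · simp [evaln] at h
  · simp only [evaln, Nat.unpaired, Option.mem_def, bind, Option.bind_eq_some_iff,
      Nat.pair_unpair] at h
    obtain ⟨-, -, v, hv, h⟩ := h
    refine ⟨v, hv, fun h₀ => ?_, fun h₀ => ?_⟩
    · simpa [h₀, eq_comm] using h
    · rw [if_neg h₀] at h
      exact evaln_mono K.le_succ h

/-- Step-bounded evaluation performs one test of the search at a time, whereas `eval` treats the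
search as a single minimization; the detour through `evaln` gives the unfolding. -/
theorem mem_eval_rfind'_of_zero {f : Code} {a m : ℕ} (h : 0 ∈ eval f (Nat.pair a m)) :
    m ∈ eval (rfind' f) (Nat.pair a m) := by
  obtain ⟨K, hK⟩ := evaln_complete.1 h
  rcases K with - | K
  · simp [evaln] at hK
  · refine evaln_sound (k := K + 1) ?_
    have hb := Nat.lt_succ_iff.1 (evaln_bound hK)
    rw [Option.mem_def] at hK
    simp [evaln, hK, hb]

theorem mem_eval_rfind'_of_ne_zero {f : Code} {a m v y : ℕ} (h : v ∈ eval f (Nat.pair a m))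
    (hv : v ≠ 0) (hy : y ∈ eval (rfind' f) (Nat.pair a (m + 1))) :
    y ∈ eval (rfind' f) (Nat.pair a m) := by
  obtain ⟨K, hK⟩ := evaln_complete.1 h
  obtain ⟨K', hK'⟩ := evaln_complete.1 hy
  refine evaln_sound (k := max K K' + 1) ?_
  replace hK := evaln_mono ((le_max_left K K').trans (Nat.le_succ _)) hK
  replace hK' := evaln_mono (le_max_right K K') hK'
  have hb := Nat.lt_succ_iff.1 (evaln_bound hK)
  simp only [evaln, Nat.unpaired, Option.mem_def, bind, Option.bind_eq_some_iff,
    Nat.unpair_pair]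
  exact ⟨(), by simpa using hb, v, hK, by rw [if_neg hv]; exact hK'⟩

/-- Only finitely many programs and, since evaluation bounded by `K` is defined only below `K`,
finitely many arguments occur. -/
theorem exists_evaln_bound (K e : ℕ) :
    ∃ B, ∀ c : Code, Encodable.encode c ≤ e → ∀ x y, y ∈ evaln K c x → y ≤ B := by
  refine ⟨(Finset.range (e + 1) ×ˢ Finset.range K).sup fun q =>
    (evaln K (Denumerable.ofNat Code q.1) q.2).getD 0, fun c hc x y hy => ?_⟩
  have hmem : (Encodable.encode c, x) ∈ Finset.range (e + 1) ×ˢ Finset.range K := by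
    simpa [Nat.lt_succ_iff, hc] using evaln_bound hy
  refine le_trans ?_ (Finset.le_sup hmem)
  simp [Option.mem_def.1 hy]

end Nat.Partrec.Code

/-! ### Correctness of recorded values and the standard interpretations. -/

namespace Interp

variable {M : Type*} {I : Interp M} {f : M → ℕ}

/-- Justifications could be circular only where a program refers to itself. For `prec` the counter
decreases; for `rfind'` it increases, and finiteness of the model makes this well-founded. -/
theorem HereditarilySound.mem_eval [Finite M] (hf : I.PairNumbering f) {c : Code}
    (h : I.HereditarilySound c) {x y : M} (hxy : I.Eval c x y) : f y ∈ c.eval (f x) := by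
  induction c generalizing x y with
  | zero =>
    have := h _ _ hxy
    rw [Justified, hf.isZero_iff] at this
    simp [Code.eval, this, pure, PFun.pure]
  | succ =>
    have := h _ _ hxy
    rw [Justified, hf.isSucc_iff] at this
    simp [Code.eval, this]
  | left =>
    have := h _ _ hxy
    rw [Justified, hf.fst_iff] at this
    simp [Code.eval, this]
  | right =>
    have := h _ _ hxy
    rw [Justified, hf.snd_iff] at this
    simp [Code.eval, this]
  | pair c d hc hd =>
    obtain ⟨a, b, ha, hb, hya, hyb⟩ := h.1 _ _ hxy
    rw [hf.fst_iff] at hya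
    rw [hf.snd_iff] at hyb
    have ha := hc h.2.1 ha
    have hb := hd h.2.2 hb
    rw [← Nat.pair_unpair (f y), ← hya, ← hyb]
    simp only [Code.eval, Seq.seq, Part.map_eq_map, Part.mem_bind_iff,
      Part.mem_map_iff]
    exact ⟨_, ⟨_, ha, rfl⟩, _, hb, rfl⟩
  | comp c d hc hd =>
    obtain ⟨z, hz, hy⟩ := h.1 _ _ hxy
    exact Part.mem_bind_iff.2 ⟨_, hd h.2.2 hz, hc h.2.1 hy⟩
  | prec c d hc hd =>
    have key : ∀ n x y, I.Eval (.prec c d) x y → (f x).unpair.2 = n →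
        f y ∈ (Code.prec c d).eval (f x) := by
      intro n
      induction n with
      | zero =>
        intro x y hxy hn
        obtain ⟨a, m, ha, hm, h₁, -⟩ := h.1 _ _ hxy
        rw [hf.fst_iff] at ha
        rw [hf.snd_iff] at hm
        rw [← Nat.pair_unpair (f x), hn, Code.eval_prec_zero, ← ha]
        exact hc h.2.1 (h₁ (hf.isZero_iff.2 (by omega)))
      | succ n ih =>
        intro x y hxy hn
        obtain ⟨a, m, ha, hm, -, h₁⟩ := h.1 _ _ hxy
        rw [hf.fst_iff] at ha
        rw [hf.snd_iff] at hm
        obtain ⟨k, hk⟩ := hf.exists_eq (x := m) (m := n) (by omega)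
        obtain ⟨x', i, q, r, hx'a, hx'k, hi, hqa, hqr, hrk, hri, hy⟩ :=
          h₁ k (hf.isSucc_iff.2 (by omega))
        rw [hf.fst_iff] at hx'a hqa hrk
        rw [hf.snd_iff] at hx'k hqr hri
        rw [← Nat.pair_unpair (f x), hn, Code.eval_prec_succ, ← ha]
        refine Part.mem_bind_iff.2 ⟨f i, ?_, ?_⟩
        · rw [hx'a, ← hk, hx'k, Nat.pair_unpair]
          exact ih _ _ hi (by omega)
        · rw [hri, ← hk, hrk, Nat.pair_unpair, hqr, hqa, Nat.pair_unpair]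
          exact hd h.2.2 hy
    exact key _ _ _ hxy rfl
  | rfind' c hc =>
    obtain ⟨B, hB⟩ : ∃ B, ∀ z, f z ≤ B := by
      obtain ⟨B, hB⟩ := (Set.finite_range f).bddAbove
      exact ⟨B, fun z => hB ⟨z, rfl⟩⟩
    -- Induction on the room `n` left between the search position and the top `B` of the model. With
    -- no room left, a further search step would need an element numbered above `B`.
    have key : ∀ n x y, I.Eval (.rfind' c) x y → B ≤ (f x).unpair.2 + n →
        f y ∈ (Code.rfind' c).eval (f x) := by
      intro n
      induction n with
      | zero =>
        intro x y hxy hn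
        obtain ⟨a, m, v, ha, hm, hv, h₁, h₂⟩ := h.1 _ _ hxy
        have hv := hc h.2 hv
        simp only [hf.isZero_iff, hf.isSucc_iff, hf.lt_iff] at h₁ h₂
        rw [hf.fst_iff] at ha
        rw [hf.snd_iff] at hm
        rw [← Nat.pair_unpair (f x), ← ha, ← hm] at hv ⊢
        by_cases h₀ : f v = 0
        · have := h₁ h₀
          rw [show f y = f m by omega]
          exact Code.mem_eval_rfind'_of_zero (h₀ ▸ hv)
        · obtain ⟨x', m', hm', -⟩ := h₂ h₀
          have := hB m'
          omega
      | succ n ih =>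
        intro x y hxy hn
        obtain ⟨a, m, v, ha, hm, hv, h₁, h₂⟩ := h.1 _ _ hxy
        have hv := hc h.2 hv
        simp only [hf.isZero_iff, hf.isSucc_iff, hf.lt_iff] at h₁ h₂
        rw [hf.fst_iff] at ha
        rw [hf.snd_iff] at hm
        rw [← Nat.pair_unpair (f x), ← ha, ← hm] at hv ⊢
        by_cases h₀ : f v = 0
        · have := h₁ h₀
          rw [show f y = f m by omega]
          exact Code.mem_eval_rfind'_of_zero (h₀ ▸ hv)
        · obtain ⟨x', m', hm', hx'a, hx'm, hy⟩ := h₂ h₀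
          rw [hf.fst_iff] at hx'a
          rw [hf.snd_iff] at hx'm
          refine Code.mem_eval_rfind'_of_ne_zero hv h₀ ?_
          rw [← hm', hx'a, hx'm, Nat.pair_unpair]
          exact ih _ _ hy (by omega)
    exact key B _ _ hxy (by omega)

/-- The interpretation on an initial segment of the natural numbers that records the computations
bounded by `K` of the programs with code at most `e`, and marks `n`. The predicates from `P (e + 2)`
on coincide. -/
def standard (e K n N : ℕ) : Interp (Fin (N + 1)) where
  lt x y := x < y
  E p a := (a : ℕ) = (Nat.unpair p).1 ∨ (a : ℕ) = (Nat.unpair p).2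
  P j p := match j with
    | 0 => (Nat.unpair p).1 < (Nat.unpair p).2
    | 1 => (p : ℕ) = n
    | j + 2 => (Nat.unpair p).2 ∈ (Denumerable.ofNat Code (min j e)).evaln K (Nat.unpair p).1

theorem standard_numbering (e K n N : ℕ) : (standard e K n N).Numbering Fin.val where
  injective := Fin.val_injective
  lt_iff := Iff.rfl
  exists_eq {x m} hm := ⟨⟨m, hm.trans_lt x.2⟩, rfl⟩

theorem standard_pairNumbering (e K n N : ℕ) : (standard e K n N).PairNumbering Fin.val :=
  (standard_numbering e K n N).pairNumbering (fun _ _ => Iff.rfl) fun _ => Iff.rfl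

theorem Numbering.linearOrderAxioms (h : I.Numbering f) : I.LinearOrderAxioms := by
  simp only [LinearOrderAxioms, h.lt_iff]
  exact ⟨fun _ => by omega, fun _ _ _ => by omega, fun _ _ _ _ => h.injective (by omega)⟩

theorem mem_evaln_of_standard_eval {e K n N : ℕ} {c : Code} {x y : Fin (N + 1)}
    (hc : Encodable.encode c ≤ e)
    (h : (standard e K n N).Eval c x y) : (y : ℕ) ∈ c.evaln K x := by
  obtain ⟨p, hp, hx, hy⟩ := h
  rw [(standard_pairNumbering e K n N).fst_iff] at hx
  rw [(standard_pairNumbering e K n N).snd_iff] at hy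
  rw [hx, hy]
  simpa [standard, hc] using hp

theorem standard_eval_of_mem_evaln {e K n N : ℕ} {c : Code} {x y : ℕ} (hc : Encodable.encode c ≤ e)
    (h : y ∈ c.evaln K x) (hN : Nat.pair x y ≤ N) : ∃ a b : Fin (N + 1),
      (a : ℕ) = x ∧ (b : ℕ) = y ∧ (standard e K n N).Eval c a b := by
  refine ⟨⟨x, by have := Nat.left_le_pair x y; omega⟩, ⟨y, by have := Nat.right_le_pair x y; omega⟩,
    rfl, rfl, ⟨Nat.pair x y, by omega⟩, ?_, ?_, ?_⟩
  · simpa [standard, hc] using h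
  · rw [(standard_pairNumbering e K n N).fst_iff]; simp
  · rw [(standard_pairNumbering e K n N).snd_iff]; simp

theorem standard_P_min (e K n N j : ℕ) :
    (standard e K n N).P (min j (e + 2)) = (standard e K n N).P j := by
  rcases j with - | - | j
  · simp
  · simp
  · rw [Nat.add_min_add_right]
    simp [standard]

/-- Arguments are below `K` and values at most `B`, so every code of such a pair is below `(K + B +
1) ^ 2` and exists in the segment. All witnesses of a justification are arguments, values or their
components. -/
theorem standard_sound {K n N e B : ℕ}
    (hB : ∀ c : Code, Encodable.encode c ≤ e → ∀ x y, y ∈ c.evaln K x → y ≤ B)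
    (hN : (K + B + 1) ^ 2 ≤ N) {c : Code} (hc : Encodable.encode c ≤ e) :
    (standard e K n N).Sound c := by
  intro x y h
  have hxy := mem_evaln_of_standard_eval hc h
  have hp := standard_pairNumbering e K n N
  have hxK := Code.evaln_bound hxy
  have hKB : K + B + 1 ≤ (K + B + 1) ^ 2 := Nat.le_self_pow (by norm_num) _
  have ev : ∀ {c : Code} {u v : ℕ}, Encodable.encode c ≤ e → v ∈ c.evaln K u →
      ∃ a b : Fin (N + 1), (a : ℕ) = u ∧ (b : ℕ) = v ∧ (standard e K n N).Eval c a b :=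
    fun {c u v} hc huv => by
      refine standard_eval_of_mem_evaln hc huv ?_
      have h₁ := Code.evaln_bound huv
      have h₂ := hB c hc _ _ huv
      refine (Nat.pair_lt_max_add_one_sq u v).le.trans (le_trans ?_ hN)
      exact Nat.pow_le_pow_left (by omega) 2
  have el : ∀ m, m ≤ K + B → ∃ z : Fin (N + 1), (z : ℕ) = m := fun m hm => ⟨⟨m, by omega⟩, rfl⟩
  cases c with
  | zero =>
    simpa [Justified, hp.isZero_iff, Code.eval, pure, PFun.pure] using Code.evaln_sound hxy
  | succ => simpa [Justified, hp.isSucc_iff, Code.eval] using Code.evaln_sound hxy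
  | left => simpa [Justified, hp.fst_iff, Code.eval] using Code.evaln_sound hxy
  | right => simpa [Justified, hp.snd_iff, Code.eval] using Code.evaln_sound hxy
  | pair c d =>
    have := Code.encode_lt_pair c d
    obtain ⟨a, ha, b, hb, hab⟩ := Code.mem_evaln_pair.1 hxy
    obtain ⟨x₁, a', hx₁, ha', h₁⟩ := ev (by omega) ha
    obtain ⟨x₂, b', hx₂, hb', h₂⟩ := ev (by omega) hb
    obtain rfl := Fin.ext hx₁
    obtain rfl := Fin.ext hx₂
    exact ⟨a', b', h₁, h₂, by rw [hp.fst_iff, ← hab, ha', Nat.unpair_pair],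
      by rw [hp.snd_iff, ← hab, hb', Nat.unpair_pair]⟩
  | comp c d =>
    have := Code.encode_lt_comp c d
    obtain ⟨z, hz, hy⟩ := Code.mem_evaln_comp hxy
    obtain ⟨x₁, z₁, hx₁, hz₁, h₁⟩ := ev (by omega) hz
    obtain ⟨z₂, y₁, hz₂, hy₁, h₂⟩ := ev (by omega) hy
    obtain rfl := Fin.ext hx₁
    obtain rfl := Fin.ext hy₁
    obtain rfl := Fin.ext (hz₁.trans hz₂.symm)
    exact ⟨z₁, h₁, h₂⟩
  | prec c d =>
    have := Code.encode_lt_prec c d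
    obtain ⟨h₁, h₂⟩ := Code.mem_evaln_prec hxy
    obtain ⟨a, ha⟩ := el _ ((Nat.unpair_left_le x).trans (by omega))
    obtain ⟨m, hm⟩ := el _ ((Nat.unpair_right_le x).trans (by omega))
    refine ⟨a, m, hp.fst_iff.2 ha, hp.snd_iff.2 hm, fun hm₀ => ?_, fun k hk => ?_⟩
    · obtain ⟨a', y', ha', hy', h₃⟩ := ev (by omega)
        (h₁ (hm.symm.trans (hp.isZero_iff.1 hm₀)))
      obtain rfl := Fin.ext (ha'.trans ha.symm)
      obtain rfl := Fin.ext hy'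
      exact h₃
    · rw [hp.isSucc_iff] at hk
      obtain ⟨i, hi, hy⟩ := h₂ k (hm.symm.trans hk)
      obtain ⟨x', i', hx', hi', h₃⟩ := ev hc hi
      obtain ⟨q, y', hq, hy', h₄⟩ := ev (by omega) hy
      obtain rfl := Fin.ext hy'
      obtain ⟨r, hr⟩ := el (Nat.pair k i) (by
        have := Code.evaln_bound hy
        have := Nat.right_le_pair (Nat.unpair x).1 (Nat.pair k i)
        omega)
      refine ⟨x', i', q, r, ?_, ?_, h₃, ?_, ?_, ?_, ?_, h₄⟩
      all_goals first
        | (rw [hp.fst_iff]; simp [hx', hq, hr, ha])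
        | (rw [hp.snd_iff]; simp [hx', hq, hr, hi'])
  | rfind' c =>
    have := Code.encode_lt_rfind' c
    obtain ⟨v, hv, h₁, h₂⟩ := Code.mem_evaln_rfind' hxy
    obtain ⟨a, ha⟩ := el _ ((Nat.unpair_left_le x).trans (by omega))
    obtain ⟨m, hm⟩ := el _ ((Nat.unpair_right_le x).trans (by omega))
    obtain ⟨x₁, v', hx₁, hv', h₃⟩ := ev (by omega) hv
    obtain rfl := Fin.ext hx₁
    simp only [Justified, hp.isZero_iff, hp.isSucc_iff, hp.lt_iff]
    refine ⟨a, m, v', hp.fst_iff.2 ha, hp.snd_iff.2 hm, h₃, fun h₀ => ?_, fun h₀ => ?_⟩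
    · have := h₁ (hv'.symm.trans h₀)
      omega
    · have hy := h₂ (hv' ▸ h₀)
      obtain ⟨x', y', hx', hy', h₄⟩ := ev hc hy
      obtain rfl := Fin.ext hy'
      obtain ⟨m', hm'⟩ := el ((Nat.unpair x₁).2 + 1) (by
        have := Code.evaln_bound hy
        have := Nat.right_le_pair (Nat.unpair x₁).1 ((Nat.unpair x₁).2 + 1)
        omega)
      refine ⟨x', m', by omega, ?_, ?_, h₄⟩
      · rw [hp.fst_iff, hx', Nat.unpair_pair, ha]
      · rw [hp.snd_iff, hx', Nat.unpair_pair, hm']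

theorem standard_hereditarilySound {K n N e B : ℕ}
    (hB : ∀ c : Code, Encodable.encode c ≤ e → ∀ x y, y ∈ c.evaln K x → y ≤ B)
    (hN : (K + B + 1) ^ 2 ≤ N) {c : Code} (hc : Encodable.encode c ≤ e) :
    (standard e K n N).HereditarilySound c := by
  have hs : (standard e K n N).Sound c := standard_sound hB hN hc
  induction c with
  | zero | succ | left | right => exact hs
  | pair c d ihc ihd =>
    have := Code.encode_lt_pair c d
    exact ⟨hs, ihc (by omega) (standard_sound hB hN (by omega)),
      ihd (by omega) (standard_sound hB hN (by omega))⟩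
  | comp c d ihc ihd =>
    have := Code.encode_lt_comp c d
    exact ⟨hs, ihc (by omega) (standard_sound hB hN (by omega)),
      ihd (by omega) (standard_sound hB hN (by omega))⟩
  | prec c d ihc ihd =>
    have := Code.encode_lt_prec c d
    exact ⟨hs, ihc (by omega) (standard_sound hB hN (by omega)),
      ihd (by omega) (standard_sound hB hN (by omega))⟩
  | rfind' c ihc =>
    have := Code.encode_lt_rfind' c
    exact ⟨hs, ihc (by omega) (standard_sound hB hN (by omega))⟩

/-- A terminating computation is recorded in the standard interpretations on all sufficiently long
initial segments of the natural numbers. -/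
theorem exists_haltingTheory_standard {c : Code} {n : ℕ} (h : (c.eval n).Dom) :
    ∃ K N₀, ∀ N, N₀ ≤ N → n ≤ N ∧ (standard (Encodable.encode c) K n N).HaltingTheory c := by
  obtain ⟨y, hy⟩ := Part.dom_iff_mem.1 h
  obtain ⟨K, hK⟩ := Code.evaln_complete.1 hy
  obtain ⟨B, hB⟩ := Code.exists_evaln_bound K (Encodable.encode c)
  -- The first summand gives soundness; the second makes room for `n` and for the record of its
  -- value `y`.
  refine ⟨K, (K + B + 1) ^ 2 + Nat.pair n y, fun N hN => ?_⟩
  have hn := Nat.left_le_pair n y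
  refine ⟨by omega, (standard_numbering _ K n N).linearOrderAxioms,
    (standard_pairNumbering _ K n N).pairingAxioms,
    standard_hereditarilySound hB (by omega) le_rfl, fun x y hx hy => ?_, ?_⟩
  · rw [(standard_numbering _ K n N).lt_iff]
    change (x : ℕ) = n at hx
    change (y : ℕ) = n at hy
    omega
  · obtain ⟨a, b, ha, -, hab⟩ := standard_eval_of_mem_evaln (n := n) (N := N) le_rfl hK (by omega)
    exact ⟨a, b, ha, hab⟩

/-- In a finite interpretation satisfying the theory the computation at the marked number
terminates. -/
theorem HaltingTheory.eval_dom [Finite M] {c : Code} (h : I.HaltingTheory c) :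
    ∃ f, I.Numbering f ∧ ∀ x, I.P 1 x → (c.eval (f x)).Dom := by
  obtain ⟨ho, hp, hs, hu, x, y, hx, hxy⟩ := h
  obtain ⟨f, hf⟩ := ho.exists_numbering
  refine ⟨f, hf, fun z hz => Part.dom_iff_mem.2 ⟨f y, ?_⟩⟩
  obtain rfl : x = z := ho.2.2 _ _ (hu _ _ hx hz) (hu _ _ hz hx)
  exact hs.mem_eval (hp.pairNumbering hf) hxy

end Interp

/-! ### The theory as a first-order sentence. -/

open FirstOrder Language
namespace FirstOrder.Language

variable {L : Language} {M : Type*} [L.Structure M]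

namespace Formula

/-- Universal quantification over the named variable `i`. -/
def allVar (i : ℕ) (φ : L.Formula ℕ) : L.Formula ℕ :=
  BoundedFormula.all (n := 0)
    (BoundedFormula.relabel (n := 1) (fun j => if j = i then Sum.inr 0 else Sum.inl j) φ)

/-- Existential quantification over the named variable `i`. -/
def exVar (i : ℕ) (φ : L.Formula ℕ) : L.Formula ℕ := ∼(allVar i ∼φ)

@[simp]
theorem realize_allVar {i : ℕ} {φ : L.Formula ℕ} {v : ℕ → M} :
    (allVar i φ).Realize v ↔ ∀ x : M, φ.Realize (Function.update v i x) := by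
  unfold allVar Formula.Realize
  rw [BoundedFormula.realize_all]
  refine forall_congr' fun x => ?_
  rw [BoundedFormula.realize_relabel]
  refine iff_of_eq (congrArg₂ _ (funext fun j => ?_) (Subsingleton.elim _ _))
  by_cases h : j = i
  · subst h; simp [Fin.snoc]
  · simp [h]

@[simp]
theorem realize_exVar {i : ℕ} {φ : L.Formula ℕ} {v : ℕ → M} :
    (exVar i φ).Realize v ↔ ∃ x : M, φ.Realize (Function.update v i x) := by
  simp [exVar]

/-- The sentence saying that a formula holds when all variables are equal. -/
def allEqual (φ : L.Formula ℕ) : L.Sentence :=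
  BoundedFormula.all (n := 0)
    (BoundedFormula.relabel (n := 1) (fun _ => Sum.inr 0 : ℕ → Empty ⊕ Fin 1) φ)

theorem realize_allEqual {φ : L.Formula ℕ} :
    M ⊨ φ.allEqual ↔ ∀ x : M, φ.Realize fun _ => x := by
  unfold allEqual Sentence.Realize Formula.Realize
  rw [BoundedFormula.realize_all]
  refine forall_congr' fun x => ?_
  rw [BoundedFormula.realize_relabel]
  refine iff_of_eq (congrArg₂ _ (funext fun j => ?_) (Subsingleton.elim _ _))
  simp [Fin.snoc]

end Formula

/-- A choice of two binary and infinitely many unary symbols. -/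
structure Vocabulary (L : Language) where
  lt : L.Relations 2
  E : L.Relations 2
  P : ℕ → L.Relations 1

namespace Vocabulary

open Formula

variable (V : Vocabulary L)

def interp (M : Type*) [L.Structure M] : Interp M where
  lt x y := Structure.RelMap V.lt ![x, y]
  E x y := Structure.RelMap V.E ![x, y]
  P j x := Structure.RelMap (V.P j) ![x]

def ltF (x y : ℕ) : L.Formula ℕ := V.lt.formula₂ (Term.var x) (Term.var y)

def eF (x y : ℕ) : L.Formula ℕ := V.E.formula₂ (Term.var x) (Term.var y)

def pF (j x : ℕ) : L.Formula ℕ := (V.P j).formula₁ (Term.var x)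

def zeroF (x : ℕ) : L.Formula ℕ := allVar (x + 1) ∼(V.ltF (x + 1) x)

def succF (x y : ℕ) : L.Formula ℕ :=
  V.ltF x y ⊓ allVar (x + y + 1) (V.ltF (x + y + 1) y ⟹ ∼(V.ltF x (x + y + 1)))

def fstF (p a : ℕ) : L.Formula ℕ :=
  V.eF p a ⊓
    ((V.pF 0 p ⟹ allVar (p + a + 1) (V.eF p (p + a + 1) ⟹ ∼(V.ltF (p + a + 1) a))) ⊓
    (∼(V.pF 0 p) ⟹ allVar (p + a + 1) (V.eF p (p + a + 1) ⟹ ∼(V.ltF a (p + a + 1)))))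

def sndF (p a : ℕ) : L.Formula ℕ :=
  V.eF p a ⊓
    ((∼(V.pF 0 p) ⟹ allVar (p + a + 1) (V.eF p (p + a + 1) ⟹ ∼(V.ltF (p + a + 1) a))) ⊓
    (V.pF 0 p ⟹ allVar (p + a + 1) (V.eF p (p + a + 1) ⟹ ∼(V.ltF a (p + a + 1)))))

def evalF (c : Code) (x y : ℕ) : L.Formula ℕ :=
  exVar (x + y + 1) (V.pF (Encodable.encode c + 2) (x + y + 1) ⊓
    (V.fstF (x + y + 1) x ⊓ V.sndF (x + y + 1) y))

def linearOrderF : L.Formula ℕ :=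
  allVar 0 ∼(V.ltF 0 0) ⊓
    (allVar 0 (allVar 1 (allVar 2 (V.ltF 0 1 ⟹ V.ltF 1 2 ⟹ V.ltF 0 2))) ⊓
    allVar 0 (allVar 1
      (∼(V.ltF 0 1) ⟹ ∼(V.ltF 1 0) ⟹ (Term.var 0 : L.Term ℕ).equal (Term.var 1))))

def pairingF : L.Formula ℕ :=
  allVar 0 (V.zeroF 0 ⟹ (V.fstF 0 0 ⊓ V.sndF 0 0)) ⊓
    allVar 0 (allVar 1 (allVar 2 (allVar 3 (V.succF 0 1 ⟹ V.fstF 0 2 ⟹ V.sndF 0 3 ⟹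
      ((V.ltF 2 3 ⟹ exVar 4 (V.succF 2 4 ⊓ ((V.ltF 4 3 ⟹ (V.fstF 1 4 ⊓ V.sndF 1 3)) ⊓
        (∼(V.ltF 4 3) ⟹ exVar 5 (V.zeroF 5 ⊓ (V.fstF 1 4 ⊓ V.sndF 1 5)))))) ⊓
      ((V.ltF 3 2 ⟹ exVar 4 (V.succF 3 4 ⊓ (V.fstF 1 2 ⊓ V.sndF 1 4))) ⊓
      (∼(V.ltF 2 3) ⟹ ∼(V.ltF 3 2) ⟹
        exVar 4 (exVar 5 (V.succF 2 4 ⊓ (V.zeroF 5 ⊓ (V.fstF 1 5 ⊓ V.sndF 1 4)))))))))))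

/-- The formula saying that the value `1` of a program at `0` is justified. -/
def justifiedF : Code → L.Formula ℕ
  | .zero => V.zeroF 1
  | .succ => V.succF 0 1
  | .left => V.fstF 0 1
  | .right => V.sndF 0 1
  | .pair f g => exVar 2 (exVar 3 (V.evalF f 0 2 ⊓ (V.evalF g 0 3 ⊓ (V.fstF 1 2 ⊓ V.sndF 1 3))))
  | .comp f g => exVar 2 (V.evalF g 0 2 ⊓ V.evalF f 2 1)
  | .prec f g => exVar 2 (exVar 3 (V.fstF 0 2 ⊓ (V.sndF 0 3 ⊓ ((V.zeroF 3 ⟹ V.evalF f 2 1) ⊓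
      allVar 4 (V.succF 4 3 ⟹ exVar 5 (exVar 6 (exVar 7 (exVar 8 (V.fstF 5 2 ⊓ (V.sndF 5 4 ⊓
        (V.evalF (.prec f g) 5 6 ⊓ (V.fstF 7 2 ⊓ (V.sndF 7 8 ⊓ (V.fstF 8 4 ⊓ (V.sndF 8 6 ⊓
          V.evalF g 7 1)))))))))))))))
  | .rfind' f => exVar 2 (exVar 3 (exVar 4 (V.fstF 0 2 ⊓ (V.sndF 0 3 ⊓ (V.evalF f 0 4 ⊓
      ((V.zeroF 4 ⟹ (∼(V.ltF 1 3) ⊓ ∼(V.ltF 3 1))) ⊓ (∼(V.zeroF 4) ⟹ exVar 5 (exVar 6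
        (V.succF 3 6 ⊓ (V.fstF 5 2 ⊓ (V.sndF 5 6 ⊓ V.evalF (.rfind' f) 5 1)))))))))))

def soundF (c : Code) : L.Formula ℕ := allVar 0 (allVar 1 (V.evalF c 0 1 ⟹ V.justifiedF c))

def hereditarilySoundF : Code → L.Formula ℕ
  | .pair f g => V.soundF (.pair f g) ⊓ (hereditarilySoundF f ⊓ hereditarilySoundF g)
  | .comp f g => V.soundF (.comp f g) ⊓ (hereditarilySoundF f ⊓ hereditarilySoundF g)
  | .prec f g => V.soundF (.prec f g) ⊓ (hereditarilySoundF f ⊓ hereditarilySoundF g)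
  | .rfind' f => V.soundF (.rfind' f) ⊓ hereditarilySoundF f
  | c => V.soundF c

def haltsAtMarkF (c : Code) : L.Formula ℕ :=
  allVar 0 (allVar 1 (V.pF 1 0 ⟹ V.pF 1 1 ⟹ ∼(V.ltF 0 1))) ⊓
    exVar 0 (exVar 1 (V.pF 1 0 ⊓ V.evalF c 0 1))

/-- The sentence expressing the theory of terminating computations of `c`. -/
def haltingSentence (c : Code) : L.Sentence :=
  -- The truth of this formula does not depend on the assignment, so any closure works in a nonempty
  -- structure.
  (V.linearOrderF ⊓ (V.pairingF ⊓ (V.hereditarilySoundF c ⊓ V.haltsAtMarkF c))).allEqual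

variable {V} {v : ℕ → M}

@[simp]
theorem realize_ltF {x y : ℕ} : (V.ltF x y).Realize v ↔ (V.interp M).lt (v x) (v y) := by
  simp [ltF, interp]

@[simp]
theorem realize_eF {x y : ℕ} : (V.eF x y).Realize v ↔ (V.interp M).E (v x) (v y) := by
  simp [eF, interp]

@[simp]
theorem realize_pF {j x : ℕ} : (V.pF j x).Realize v ↔ (V.interp M).P j (v x) := by
  simp [pF, interp]

@[simp]
theorem realize_zeroF {x : ℕ} : (V.zeroF x).Realize v ↔ (V.interp M).IsZero (v x) := by
  simp [zeroF, Interp.IsZero]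

theorem update_fresh_left (x y : ℕ) (a : M) : Function.update v (x + y + 1) a x = v x :=
  Function.update_of_ne (by omega) _ _

theorem update_fresh_right (x y : ℕ) (a : M) : Function.update v (x + y + 1) a y = v y :=
  Function.update_of_ne (by omega) _ _

@[simp]
theorem realize_succF {x y : ℕ} :
    (V.succF x y).Realize v ↔ (V.interp M).IsSucc (v x) (v y) := by
  simp [succF, Interp.IsSucc, update_fresh_left, update_fresh_right]

@[simp]
theorem realize_fstF {p a : ℕ} : (V.fstF p a).Realize v ↔ (V.interp M).Fst (v p) (v a) := by
  simp [fstF, Interp.Fst, update_fresh_left, update_fresh_right]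

@[simp]
theorem realize_sndF {p a : ℕ} : (V.sndF p a).Realize v ↔ (V.interp M).Snd (v p) (v a) := by
  simp [sndF, Interp.Snd, update_fresh_left, update_fresh_right]

@[simp]
theorem realize_evalF {c : Code} {x y : ℕ} :
    (V.evalF c x y).Realize v ↔ (V.interp M).Eval c (v x) (v y) := by
  simp [evalF, Interp.Eval, update_fresh_left, update_fresh_right]

theorem realize_linearOrderF : V.linearOrderF.Realize v ↔ (V.interp M).LinearOrderAxioms := by
  simp [linearOrderF, Interp.LinearOrderAxioms]

theorem realize_pairingF : V.pairingF.Realize v ↔ (V.interp M).PairingAxioms := by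
  simp [pairingF, Interp.PairingAxioms]

theorem realize_justifiedF {c : Code} :
    (V.justifiedF c).Realize v ↔ (V.interp M).Justified c (v 0) (v 1) := by
  cases c <;> simp [justifiedF, Interp.Justified]

theorem realize_soundF {c : Code} : (V.soundF c).Realize v ↔ (V.interp M).Sound c := by
  simp [soundF, Interp.Sound, realize_justifiedF]

theorem realize_hereditarilySoundF {c : Code} :
    (V.hereditarilySoundF c).Realize v ↔ (V.interp M).HereditarilySound c := by
  induction c <;>
    simp [hereditarilySoundF, Interp.HereditarilySound, realize_soundF, *]

theorem realize_haltsAtMarkF {c : Code} :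
    (V.haltsAtMarkF c).Realize v ↔ (V.interp M).HaltsAtMark c := by
  simp [haltsAtMarkF, Interp.HaltsAtMark]

theorem realize_haltingSentence [Nonempty M] {c : Code} :
    M ⊨ V.haltingSentence c ↔ (V.interp M).HaltingTheory c := by
  simp [haltingSentence, realize_allEqual, Interp.HaltingTheory, realize_linearOrderF,
    realize_pairingF, realize_hereditarilySoundF, realize_haltsAtMarkF]

end Vocabulary

end FirstOrder.Language

/-! ### The sentence fixing the input. -/

namespace FirstOrder.Language.Vocabulary

variable {L : Language} (V : Vocabulary L) {M : Type*} [L.Structure M]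

/-- The formula saying that the `j`-th iterated successor of the last variable is not marked. -/
def notMarked : ℕ → (d : ℕ) → L.BoundedFormula Empty (d + 1)
  | 0, d => ∼((V.P 1).boundedFormula₁ (&(Fin.last d)))
  -- Variable `d` is the current element, `d + 1` its successor, and `d + 2` ranges over possible
  -- elements in between. Bound variables are numbered directly here, instead of by relabelling
  -- named ones, so that the code of the formula can be computed from `j`.
  | j + 1, d =>
    (V.lt.boundedFormula₂ (&(Fin.last d).castSucc) (&(Fin.last (d + 1))) ⟹
      (V.lt.boundedFormula₂ (&(Fin.last (d + 2))) (&(Fin.last (d + 1)).castSucc) ⟹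
        ∼(V.lt.boundedFormula₂ (&(Fin.last d).castSucc.castSucc) (&(Fin.last (d + 2))))).all ⟹
      notMarked j (d + 1)).all

/-- The sentence saying that the `n`-th element is marked. -/
def markSentence (n : ℕ) : L.Sentence :=
  ∼(((∼(V.lt.boundedFormula₂ (&(1 : Fin 2)) (&(0 : Fin 2)))).all ⟹ V.notMarked n 0).all)

variable {V}

theorem realize_notMarked {f : M → ℕ} (hf : (V.interp M).Numbering f) (j d : ℕ)
    (v : Fin (d + 1) → M) : (V.notMarked j d).Realize default v ↔
      ∀ y, f y = f (v (Fin.last d)) + j → ¬ (V.interp M).P 1 y := by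
  induction j generalizing d with
  | zero =>
    have : (V.notMarked 0 d).Realize default v ↔ ¬ (V.interp M).P 1 (v (Fin.last d)) := by
      simp [notMarked, interp]
    rw [this]
    refine ⟨fun h y hy => ?_, fun h => h _ rfl⟩
    rwa [hf.injective (hy.trans (add_zero _))]
  | succ j ih =>
    have : (V.notMarked (j + 1) d).Realize default v ↔
        ∀ z, (V.interp M).IsSucc (v (Fin.last d)) z →
          (V.notMarked j (d + 1)).Realize default (Fin.snoc v z : Fin (d + 2) → M) := by
      simp [notMarked, interp, Interp.IsSucc]
    simp only [this, ih, Fin.snoc_last, hf.isSucc_iff]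
    refine ⟨fun h y hy => ?_, fun h z hz y hy => h y (by omega)⟩
    obtain ⟨z, hz⟩ := hf.exists_eq (x := y) (m := f (v (Fin.last d)) + 1) (by omega)
    exact h z hz y (by omega)

theorem realize_markSentence {f : M → ℕ} (hf : (V.interp M).Numbering f) (n : ℕ) :
    M ⊨ V.markSentence n ↔ ∃ y, f y = n ∧ (V.interp M).P 1 y := by
  have : M ⊨ V.markSentence n ↔ ¬ ∀ x, (V.interp M).IsZero x →
      (V.notMarked n 0).Realize default (Fin.snoc default x : Fin 1 → M) := by
    simp [markSentence, Sentence.Realize, Formula.Realize, Interp.IsZero, interp, Fin.snoc]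
  simp only [this, realize_notMarked hf, hf.isZero_iff]
  push Not
  constructor
  · rintro ⟨x, hx, y, hy, h⟩
    refine ⟨y, ?_, h⟩
    simpa [Fin.snoc, hx] using hy
  · rintro ⟨y, hy, h⟩
    obtain ⟨x, hx⟩ := hf.exists_eq (Nat.zero_le (f y))
    exact ⟨x, hx, y, by simpa [Fin.snoc, hx] using hy, h⟩

end FirstOrder.Language.Vocabulary

/-! ### Computability of the reduction and its correctness. -/

namespace RelSignature

variable {S : RelSignature} (V : Vocabulary S.lang)

def ltCode (x y : ℕ) : ℕ :=
  Nat.pair 2 (Nat.pair V.lt.1 (Nat.pair x (Nat.pair y 0 + 1) + 1))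

theorem code_lt {n : ℕ} (i j : Fin n) :
    S.code (V.lt.boundedFormula₂ (&i) (&j) : S.lang.BoundedFormula Empty n) = ltCode V i j := by
  simp [Relations.boundedFormula₂, Relations.boundedFormula, code, termCode, ltCode]

/-- In `notMarked` the depth grows while the counter falls, so their sum `n` is constant. With `n`
as a parameter and the depth recovered as `n - (j + 1)`, this is plain primitive recursion on the
counter. -/
def notMarkedCode (n : ℕ) : ℕ → ℕ
  | 0 => Nat.pair 3 (Nat.pair (Nat.pair 2 (Nat.pair (V.P 1).1 (Nat.pair n 0 + 1))) 0)
  | j + 1 => Nat.pair 4 (Nat.pair 3 (Nat.pair (ltCode V (n - (j + 1)) (n - (j + 1) + 1))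
      (Nat.pair 3 (Nat.pair
        (Nat.pair 4 (Nat.pair 3 (Nat.pair (ltCode V (n - (j + 1) + 2) (n - (j + 1) + 1))
          (Nat.pair 3 (Nat.pair (ltCode V (n - (j + 1)) (n - (j + 1) + 2)) 0)))))
        (notMarkedCode n j)))))

theorem code_imp {n : ℕ} (φ ψ : S.lang.BoundedFormula Empty n) :
    S.code (φ ⟹ ψ) = Nat.pair 3 (Nat.pair (S.code φ) (S.code ψ)) := rfl

theorem code_all {n : ℕ} (φ : S.lang.BoundedFormula Empty (n + 1)) :
    S.code φ.all = Nat.pair 4 (S.code φ) := rfl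

theorem code_not {n : ℕ} (φ : S.lang.BoundedFormula Empty n) :
    S.code (∼φ) = Nat.pair 3 (Nat.pair (S.code φ) 0) := rfl

theorem code_inf {n : ℕ} (φ ψ : S.lang.BoundedFormula Empty n) :
    S.code (φ ⊓ ψ) = S.code (∼(φ ⟹ ∼ψ)) := rfl

theorem code_notMarked (j d : ℕ) : S.code (V.notMarked j d) = notMarkedCode V (d + j) j := by
  induction j generalizing d with
  | zero =>
    simp [Vocabulary.notMarked, Relations.boundedFormula₁, Relations.boundedFormula, code,
      termCode, notMarkedCode, code_not]
  | succ j ih =>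
    rw [Vocabulary.notMarked, notMarkedCode, show d + (j + 1) - (j + 1) = d by omega,
      show d + (j + 1) = d + 1 + j by omega, ← ih]
    simp only [code_all, code_imp, code_not]
    rw [code_lt, code_lt, code_lt]
    simp

theorem primrec₂_ltCode : Primrec₂ (ltCode V) := by
  unfold ltCode
  exact Primrec₂.natPair.comp (.const _) (Primrec₂.natPair.comp (.const _)
    (Primrec.succ.comp (Primrec₂.natPair.comp .fst (Primrec.succ.comp
      (Primrec₂.natPair.comp .snd (.const _))))))

theorem primrec₂_notMarkedCode : Primrec₂ (notMarkedCode V) := by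
  have hd : Primrec fun q : ℕ × ℕ × ℕ => q.1 - (q.2.1 + 1) :=
    Primrec.nat_sub.comp .fst (Primrec.succ.comp (Primrec.fst.comp .snd))
  have hd₁ := Primrec.succ.comp hd
  have hd₂ := Primrec.succ.comp hd₁
  have hp := Primrec₂.natPair
  have h := Primrec.nat_rec
    (f := fun n : ℕ => Nat.pair 3 (Nat.pair (Nat.pair 2 (Nat.pair (V.P 1).1 (Nat.pair n 0 + 1))) 0))
    (g := fun (n : ℕ) (q : ℕ × ℕ) =>
      Nat.pair 4 (Nat.pair 3 (Nat.pair (ltCode V (n - (q.1 + 1)) (n - (q.1 + 1) + 1))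
      (Nat.pair 3 (Nat.pair
        (Nat.pair 4 (Nat.pair 3 (Nat.pair (ltCode V (n - (q.1 + 1) + 2) (n - (q.1 + 1) + 1))
          (Nat.pair 3 (Nat.pair (ltCode V (n - (q.1 + 1)) (n - (q.1 + 1) + 2)) 0)))))
        q.2)))))
    (hp.comp (.const _) (hp.comp (hp.comp (.const _) (hp.comp (.const _)
      (Primrec.succ.comp (hp.comp .id (.const _))))) (.const _)))
    (hp.comp (.const _) (hp.comp (.const _) (hp.comp ((primrec₂_ltCode V).comp hd hd₁)
      (hp.comp (.const _) (hp.comp (hp.comp (.const _) (hp.comp (.const _)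
        (hp.comp ((primrec₂_ltCode V).comp hd₂ hd₁)
        (hp.comp (.const _) (hp.comp ((primrec₂_ltCode V).comp hd hd₂) (.const _))))))
        (Primrec.snd.comp .snd))))))
  refine h.of_eq fun n j => ?_
  induction j with
  | zero => rfl
  | succ j ih =>
    simp only [notMarkedCode, ← ih]

theorem primrec_code_inf_markSentence (φ : S.lang.Sentence) :
    Primrec fun n => S.code (φ ⊓ V.markSentence n) := by
  have hp := Primrec₂.natPair
  have h : ∀ n, S.code (φ ⊓ V.markSentence n) =
      Nat.pair 3 (Nat.pair (Nat.pair 3 (Nat.pair (S.code φ) (Nat.pair 3 (Nat.pair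
        (Nat.pair 3 (Nat.pair (Nat.pair 4 (Nat.pair 3 (Nat.pair
          (Nat.pair 4 (Nat.pair 3 (Nat.pair (ltCode V 1 0) 0))) (notMarkedCode V n n)))) 0)) 0))))
        0) := fun n => by
    have h₁ : S.code (V.notMarked n 0) = notMarkedCode V n n := by
      simpa only [Nat.zero_add] using code_notMarked V n 0
    rw [← h₁, code_inf, code_not, code_imp, code_not, Vocabulary.markSentence, code_not, code_all,
      code_imp, code_all, code_not, code_lt]
    rfl
  refine Primrec.of_eq ?_ fun n => (h n).symm
  exact hp.comp (.const _) (hp.comp (hp.comp (.const _) (hp.comp (.const _) (hp.comp (.const _)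
    (hp.comp (hp.comp (.const _) (hp.comp (hp.comp (.const _) (hp.comp (.const _)
      (hp.comp (.const _) ((primrec₂_notMarkedCode V).comp .id .id)))) (.const _))) (.const _)))))
    (.const _))

/-- The structure over a signature given by the interpretation of finitely many of its symbols; all
other relations are empty. -/
@[reducible]
def structureOfInterp (k : ℕ) {M : Type} (I : Interp M) : S.lang.Structure M where
  funMap f := Empty.elim f
  RelMap R x :=
    -- Comparing lists instead of tuples avoids casts between arities.
    (∃ a b, List.ofFn x = [a, b] ∧ (R.1 = V.lt.1 ∧ I.lt a b ∨ R.1 = V.E.1 ∧ I.E a b)) ∨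
      ∃ a, List.ofFn x = [a] ∧ ∃ j ≤ k, R.1 = (V.P j).1 ∧ I.P j a

theorem interp_structureOfInterp {k : ℕ} {M : Type} {I : Interp M} (hV : V.lt.1 ≠ V.E.1)
    (hP : ∀ j, V.P (min j k) = V.P j)
    (hinj : ∀ i ≤ k, ∀ j ≤ k, (V.P i).1 = (V.P j).1 → i = j)
    (hI : ∀ j, I.P (min j k) = I.P j) :
    @Vocabulary.interp _ V M (structureOfInterp V k I) = I := by
  obtain ⟨lt, E, P⟩ := I
  change ∀ j, P (min j k) = P j at hI
  rw [Vocabulary.interp, Interp.mk.injEq]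
  refine ⟨?_, ?_, ?_⟩
  · ext x y
    simp [Structure.RelMap, hV]
  · ext x y
    simp [Structure.RelMap, hV.symm]
  · ext j x
    constructor
    · rintro (⟨a, b, h, -⟩ | ⟨a, h, i, hi, hij, hia⟩)
      · simp at h
      · obtain rfl : x = a := by simpa using h
        rw [← hP j] at hij
        have := hinj _ (min_le_right _ _) _ hi hij
        rw [← hI j]
        exact this ▸ hia
    · intro h
      exact .inr ⟨x, by simp, min j k, min_le_right _ _, by rw [hP], by change P _ x; rwa [hI]⟩

/-- A vocabulary whose first unary symbols are distinct, in a sufficiently rich signature. -/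
theorem exists_vocabulary (S : RelSignature) (k : ℕ) (h₂ : 2 ≤ S.numOfArity 2)
    (h₁ : k + 1 ≤ S.numOfArity 1) :
    ∃ V : Vocabulary S.lang, V.lt.1 ≠ V.E.1 ∧ (∀ j, V.P (min j k) = V.P j) ∧
      ∀ i ≤ k, ∀ j ≤ k, (V.P i).1 = (V.P j).1 → i = j := by
  obtain ⟨a, ha, b, hb, hab⟩ := Finset.one_lt_card.1 h₂
  let e := Finset.orderEmbOfCardLe _ h₁
  have he : ∀ i, S.arity (e i) = 1 := fun i =>
    (Finset.mem_filter.1 (Finset.orderEmbOfCardLe_mem _ h₁ i)).2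
  refine ⟨⟨⟨a, (Finset.mem_filter.1 ha).2⟩, ⟨b, (Finset.mem_filter.1 hb).2⟩,
    fun j => ⟨e ⟨min j k, by omega⟩, he _⟩⟩, hab, fun j => ?_, fun i hi j hj hij => ?_⟩
  · exact Subtype.ext (congrArg e (Fin.ext (by simp)))
  · have := e.injective hij
    simp only [Fin.mk.injEq] at this
    omega

variable {V}

/-- The models of the sentence expressing termination have unbounded treewidth if there are any. -/
theorem treewidthBounded_iff {c : Code} (hV : V.lt.1 ≠ V.E.1)
    (hP : ∀ j, V.P (min j (Encodable.encode c + 2)) = V.P j)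
    (hinj : ∀ i ≤ Encodable.encode c + 2, ∀ j ≤ Encodable.encode c + 2,
      (V.P i).1 = (V.P j).1 → i = j) (n : ℕ) :
    S.TreewidthBounded (V.haltingSentence c ⊓ V.markSentence n) ↔ ¬ (c.eval n).Dom := by
  constructor
  · intro hb hn
    obtain ⟨K, N₀, hN⟩ := Interp.exists_haltingTheory_standard hn
    obtain ⟨w, hw⟩ := Set.Finite.bddAbove hb
    obtain ⟨N, hN₀, hN₁, hNw⟩ : ∃ N : ℕ, N₀ ≤ N ∧ 1 ≤ N ∧ w < N :=
      ⟨N₀ + w.toNat + 1, by omega, by omega, by omega⟩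
    obtain ⟨hnN, hT⟩ := hN N hN₀
    set I := Interp.standard (Encodable.encode c) K n N with hI
    let _ := structureOfInterp V (Encodable.encode c + 2) I
    have hVI : V.interp (Fin (N + 1)) = I :=
      interp_structureOfInterp V hV hP hinj (Interp.standard_P_min _ _ _ _)
    have hmodel : Fin (N + 1) ⊨ V.haltingSentence c ⊓ V.markSentence n := by
      rw [Sentence.Realize, Formula.realize_inf]
      refine ⟨Vocabulary.realize_haltingSentence.2 (hVI ▸ hT),
        (Vocabulary.realize_markSentence (f := Fin.val)
          (hVI ▸ Interp.standard_numbering _ _ _ _) n).2 ⟨⟨n, by omega⟩, rfl, ?_⟩⟩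
      rw [hVI]
      rfl
    have hle := hw ⟨Fin (N + 1), _, inferInstance, inferInstance, hmodel, rfl⟩
    have hrel : ∀ a b : Fin (N + 1), a < b → Structure.RelMap V.lt ![a, b] := fun a b hab => by
      change (V.interp (Fin (N + 1))).lt a b
      rw [hVI]
      exact hab
    have hge := S.le_treewidth_of_clique (M := Fin (N + 1)) Finset.univ (by simp; omega) (by
      intro a _ b _ hab
      rcases lt_or_gt_of_ne hab with h | h
      · exact ⟨2, V.lt, _, hrel a b h, ⟨0, rfl⟩, ⟨1, rfl⟩⟩
      · exact ⟨2, V.lt, _, hrel b a h, ⟨1, rfl⟩, ⟨0, rfl⟩⟩)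
    simp only [Finset.card_univ, Fintype.card_fin] at hge
    push_cast at hge
    omega
  · intro hn
    -- There is no finite model at all: one would contain a correct value of `c` at `n`.
    refine Set.Finite.subset Set.finite_empty ?_
    rintro _ ⟨M, _, _, _, hM, -⟩
    rw [Sentence.Realize, Formula.realize_inf] at hM
    obtain ⟨f, hf, hdom⟩ := (Vocabulary.realize_haltingSentence.1 hM.1).eval_dom
    obtain ⟨y, rfl, hy⟩ := (Vocabulary.realize_markSentence hf n).1 hM.2
    exact hn (hdom y hy)

end RelSignature

/-- There is a partial recursive function whose domain is not computable. -/
theorem Nat.Partrec.Code.exists_not_computable_dom :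
    ∃ c : Code, ¬ ∃ d : ℕ → Bool, Computable d ∧ ∀ n, d n = true ↔ ¬ (c.eval n).Dom := by
  -- Running the `n`-th program at `0` is partial recursive, and its domain is the halting problem.
  have hf : Partrec fun n : ℕ => Code.eval (Denumerable.ofNat Code n) 0 :=
    Code.eval_part.comp (Computable.ofNat Code) (Computable.const 0)
  obtain ⟨c, hc⟩ := Code.exists_code.1 (Partrec.nat_iff.1 hf)
  refine ⟨c, fun ⟨d, hd, h⟩ => ComputablePred.halting_problem 0 ?_⟩
  refine ComputablePred.computable_iff.2 ⟨fun e => !d (Encodable.encode e),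
    Primrec.not.to_comp.comp (hd.comp Computable.encode), funext fun e => ?_⟩
  have := h (Encodable.encode e)
  simp only [hc, Denumerable.ofNat_encode] at this
  rw [eq_iff_iff, Bool.not_eq_true', ← Bool.not_eq_true, this, not_not]

theorem mainTheorem5 :
    ∃ k : ℕ, ∀ S : RelSignature, 2 ≤ S.numOfArity 2 → k ≤ S.numOfArity 1 →
      ¬ S.TreewidthBoundednessDecidable := by
  obtain ⟨c, hc⟩ := Code.exists_not_computable_dom
  -- The predicates used are `P 0`, `P 1` and `P (encode d + 2)` for subprograms `d` of `c`.
  -- Subprograms have smaller codes, so all indices are at most `encode c + 2`.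
  refine ⟨Encodable.encode c + 2 + 1, fun S h₂ h₁ ⟨d, hd, h⟩ => hc ?_⟩
  obtain ⟨V, hV, hP, hinj⟩ := S.exists_vocabulary _ h₂ h₁
  exact ⟨_, hd.comp (RelSignature.primrec_code_inf_markSentence V (V.haltingSentence c)).to_comp,
    fun n => (h _).trans (RelSignature.treewidthBounded_iff hV hP hinj n)⟩
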